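/- The language $\mathcal{L}$ of tense logic has formulas built from countably many variables $p_0,p_1,\dots$ with $\bot$, $\to$, $\Box$ and $\blacklozenge$; as usual $\neg\varphi:=\varphi\to\bot$, $\top:=\neg\bot$, $\varphi\vee\psi:=\neg\varphi\to\psi$ and $\Diamond\varphi:=\neg\Box\neg\varphi$. A frame is a pair $(X,R)$ with $X\neq\varnothing$ and $R\subseteq X\times X$; under a valuation, $\Box\varphi$ is true at $x$ iff $\varphi$ is true at every $y$ with $Rxy$, and $\blacklozenge\varphi$ is true at $x$ iff $\varphi$ is true at some $y$ with $Ryx$; a formula is valid in $(X,R)$ if it is true at every point under every valuation. A tense logic is a set $L\subseteq\mathcal{L}$ that contains all classical propositional tautologies, is closed under modus ponens and uniform substitution, and satisfies $(\blacklozenge\varphi\to\psi)\in L$ iff $(\varphi\to\Box\psi)\in L$ for all formulas $\varphi,\psi$. Let $\mathsf{K}_t$ be the least tense logic, $\mathsf{NExt}(\mathsf{K}_t)$ the set of all tense logics (including the inconsistent logic $\mathcal{L}$), and $L\oplus\varphi$ the least tense logic containing $L\cup\{\varphi\}$. Let $\mathsf{Fr}(L)$ be the class of all frames in which every formula of $L$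 is valid, and let $$\mathsf{deg}(L)=\bigl|\{L'\in\mathsf{NExt}(\mathsf{K}_t):\mathsf{Fr}(L')=\mathsf{Fr}(L)\}\bigr|$$ be the degree of Kripke-incompleteness of $L$ in $\mathsf{NExt}(\mathsf{K}_t)$. **Theorem.** Let $L\in\mathsf{NExt}(\mathsf{K}_t)$ with $L\neq\mathsf{K}_t$ and $L\neq\mathsf{K}_t\oplus(\Diamond\top\vee\blacklozenge\top)$. Then $\mathsf{deg}(L)=2^{\aleph_0}$. -/

import Mathlib

universe u

namespace TenseLogic

/-- Formulas of the language of tense logic, with variables `p_i` indexed by `i : ℕ` and primitive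
connectives `⊥`, `→`, `□` (always in the future) and `⧫` (sometime in the past). -/
inductive Formula : Type
  | var : ℕ → Formula
  | bot : Formula
  | imp : Formula → Formula → Formula
  | box : Formula → Formula
  | bdia : Formula → Formula

namespace Formula

/-- Negation `¬φ`. -/
def neg (φ : Formula) : Formula := imp φ bot

/-- Verum `⊤`. -/
def top : Formula := neg bot

/-- Disjunction `φ ∨ ψ`. -/
def or (φ ψ : Formula) : Formula := imp (neg φ) ψ

/-- Future possibility `◇φ := ¬□¬φ`. -/
def dia (φ : Formula) : Formula := neg (box (neg φ))

/-- The homomorphic extension of `s : ℕ → Formula` to all formulas. -/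
def subst (s : ℕ → Formula) : Formula → Formula
  | var i => s i
  | bot => bot
  | imp φ ψ => imp (subst s φ) (subst s ψ)
  | box φ => box (subst s φ)
  | bdia φ => bdia (subst s φ)

/-- `φ` is an instance of a classical propositional tautology: it is true under every classical
truth assignment, formulas of the form `p`, `□ψ`, `⧫ψ` being treated as atoms. -/
def IsTautology (φ : Formula) : Prop :=
  ∀ v : Formula → Prop, ¬ v bot → (∀ α β, v (imp α β) ↔ (v α → v β)) → v φ

end Formula

open Formula

/-- A (Kripke) frame: a nonempty set with a binary relation. -/
structure Frame where
  World : Type u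
  nonempty : Nonempty World
  Rel : World → World → Prop

/-- Truth of a formula at a point of a frame under a valuation. -/
def Frame.Sat (F : Frame.{u}) (V : ℕ → Set F.World) : F.World → Formula → Prop
  | x, var i => x ∈ V i
  | _, bot => False
  | x, imp φ ψ => F.Sat V x φ → F.Sat V x ψ
  | x, box φ => ∀ y, F.Rel x y → F.Sat V y φ
  | x, bdia φ => ∃ y, F.Rel y x ∧ F.Sat V y φ

/-- Validity of a formula in a frame. -/
def Frame.Valid (F : Frame.{u}) (φ : Formula) : Prop :=
  ∀ (V : ℕ → Set F.World) (x : F.World), F.Sat V x φ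

/-- The class `Fr(Σ)` of all frames (in the universe `u`) validating every formula of `Σ`. -/
def Fr (S : Set Formula) : Set Frame.{u} :=
  {F | ∀ φ ∈ S, F.Valid φ}

/-- Tense logics. -/
structure IsTenseLogic (L : Set Formula) : Prop where
  taut : ∀ φ, IsTautology φ → φ ∈ L
  adj : ∀ φ ψ, imp (bdia φ) ψ ∈ L ↔ imp φ (box ψ) ∈ L
  mp : ∀ φ ψ, φ ∈ L → imp φ ψ ∈ L → ψ ∈ L
  subst : ∀ (s : ℕ → Formula) φ, φ ∈ L → φ.subst s ∈ L

/-- The least tense logic `K_t` (see `isTenseLogic_Kt`). -/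
def Kt : Set Formula := {φ | ∀ L, IsTenseLogic L → φ ∈ L}

/-- `L ⊕ Σ`, the least tense logic containing `L ∪ Σ`. -/
def oplus (L S : Set Formula) : Set Formula :=
  {φ | ∀ L', IsTenseLogic L' → L ∪ S ⊆ L' → φ ∈ L'}

/-- `NExt(L₀)`, the set of all tense logics extending `L₀`. -/
def NExt (L₀ : Set Formula) : Set (Set Formula) :=
  {L | IsTenseLogic L ∧ L₀ ⊆ L}

/-- The degree of Kripke-incompleteness of `L` in `NExt(L₀)`: the cardinality of the set of all
logics in `NExt(L₀)` which have the same frames as `L`. -/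
noncomputable def deg (L₀ L : Set Formula) : Cardinal.{0} :=
  Cardinal.mk {L' : Set Formula // L' ∈ NExt L₀ ∧ Fr.{u} L' = Fr.{u} L}

theorem isTenseLogic_Kt : IsTenseLogic Kt where
  taut φ h L hL := hL.taut φ h
  adj φ ψ := ⟨fun h L hL => (hL.adj φ ψ).1 (h L hL), fun h L hL => (hL.adj φ ψ).2 (h L hL)⟩
  mp φ ψ h h' L hL := hL.mp φ ψ (h L hL) (h' L hL)
  subst s φ h L hL := hL.subst s φ (h L hL)

end TenseLogic

namespace TenseLogic

open Formula

/-! Some φ ∈ L fails at a point w that has a neighbour; otherwise L would be one of the two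
exceptions (`exists_refuted_at_neighbour`, which rests on the Kripke completeness of K_t). Let N be
the depth of φ. Unfold the frame around w along zigzag walks of length at most N, and attach a copy
of (ℕ, <) by a single arrow from n to the end a of a walk of length exactly N, too far away for φ to
notice (`sat_glue`). Valuations are restricted to sets finite or cofinite on ℕ. The logic S n of
this general frame contains axioms that have no Kripke frame. The formula α = ◇^{2N+1}⊤ defines the
copy of ℕ; the axioms make the α-points a serial, well-founded, past-linear transitive order and
impose McKinsey's formula there. That formula holds for finite and cofinite sets, but in a Kripke
frame an alternating valuation refutes it (`Fr_eq_empty_of_noFrameAxioms`).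

For I ⊆ ℕ let T I be the intersection of the S n with n ∈ I. It has no frames, so L ∩ T I has the
same frames as L (`Fr_inter_eq`). Since `noExit` for n lies in S m exactly when m ≠ n, the
disjunction of φ with `noExit` for n, boxed N + 1 times in both directions, lies in L ∩ T I exactly
when n ∉ I. Thus I can be recovered from L ∩ T I, which gives 2^ℵ₀ logics; there are no more because
formulas are countable. -/

/-! ### Truth of derived connectives -/

/-- Conjunction. -/
def Formula.and (φ ψ : Formula) : Formula := neg (imp φ (neg ψ))

/-- `◇^k ⊤`. -/
def Formula.diaPow : ℕ → Formula
  | 0 => top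
  | k + 1 => dia (diaPow k)

/-- `⧫^k ⊤`. -/
def Formula.bdiaPow : ℕ → Formula
  | 0 => top
  | k + 1 => bdia (bdiaPow k)

/-- `φ` holds here and at all successors and predecessors. -/
def Formula.nbox (φ : Formula) : Formula := and φ (and (box φ) (neg (bdia (neg φ))))

/-- `φ` holds at all points reachable in at most `k` steps along the relation or its converse. -/
def Formula.nboxPow (φ : Formula) : ℕ → Formula
  | 0 => φ
  | k + 1 => nbox (nboxPow φ k)

/-- Modal depth. -/
def Formula.depth : Formula → ℕ
  | var _ => 0
  | bot => 0
  | imp φ ψ => max (depth φ) (depth ψ)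
  | box φ => depth φ + 1
  | bdia φ => depth φ + 1

namespace Frame

/-- There is an `R`-path of length `k` starting at `x`. -/
def HasChain (F : Frame.{u}) : ℕ → F.World → Prop
  | 0, _ => True
  | k + 1, x => ∃ y, F.Rel x y ∧ HasChain F k y

/-- There is an `R`-path of length `k` ending at `x`. -/
def HasBChain (F : Frame.{u}) : ℕ → F.World → Prop
  | 0, _ => True
  | k + 1, x => ∃ y, F.Rel y x ∧ HasBChain F k y

/-- `y` is reachable from `x` in at most `k` steps along the relation or its converse. -/
def Near (F : Frame.{u}) : ℕ → F.World → F.World → Prop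
  | 0, x, y => x = y
  | k + 1, x, y => ∃ z, (x = z ∨ F.Rel x z ∨ F.Rel z x) ∧ Near F k z y

section Sat

variable {F : Frame.{u}} {V : ℕ → Set F.World} {x : F.World} {φ ψ : Formula}

@[simp] theorem sat_var {i : ℕ} : F.Sat V x (var i) ↔ x ∈ V i := Iff.rfl

@[simp] theorem sat_bot : ¬ F.Sat V x bot := id

@[simp] theorem sat_imp : F.Sat V x (imp φ ψ) ↔ (F.Sat V x φ → F.Sat V x ψ) := Iff.rfl

@[simp] theorem sat_box : F.Sat V x (box φ) ↔ ∀ y, F.Rel x y → F.Sat V y φ := Iff.rfl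

@[simp] theorem sat_bdia : F.Sat V x (bdia φ) ↔ ∃ y, F.Rel y x ∧ F.Sat V y φ := Iff.rfl

@[simp] theorem sat_neg : F.Sat V x (neg φ) ↔ ¬ F.Sat V x φ := Iff.rfl

@[simp] theorem sat_top : F.Sat V x top := id

@[simp] theorem sat_or : F.Sat V x (or φ ψ) ↔ (F.Sat V x φ ∨ F.Sat V x ψ) := by
  simp only [Formula.or, sat_imp, sat_neg]; tauto

@[simp] theorem sat_and : F.Sat V x (and φ ψ) ↔ (F.Sat V x φ ∧ F.Sat V x ψ) := by
  simp only [Formula.and, sat_imp, sat_neg]; tauto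

@[simp] theorem sat_dia : F.Sat V x (dia φ) ↔ ∃ y, F.Rel x y ∧ F.Sat V y φ := by
  simp [Formula.dia]

@[simp] theorem sat_diaPow {k : ℕ} : F.Sat V x (diaPow k) ↔ F.HasChain k x := by
  induction k generalizing x with
  | zero => simp [diaPow, HasChain]
  | succ k ih => simp [diaPow, HasChain, ih]

@[simp] theorem sat_bdiaPow {k : ℕ} : F.Sat V x (bdiaPow k) ↔ F.HasBChain k x := by
  induction k generalizing x with
  | zero => simp [bdiaPow, HasBChain]
  | succ k ih => simp [bdiaPow, HasBChain, ih]

@[simp] theorem sat_nboxPow {k : ℕ} :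
    F.Sat V x (nboxPow φ k) ↔ ∀ y, F.Near k x y → F.Sat V y φ := by
  induction k generalizing x with
  | zero => simp [nboxPow, Near]
  | succ k ih =>
    simp only [nboxPow, nbox, sat_and, sat_box, sat_neg, sat_bdia, ih, Near]
    constructor
    · rintro ⟨h1, h2, h3⟩ y ⟨z, rfl | h | h, hz⟩
      · exact h1 y hz
      · exact h2 z h y hz
      · by_contra hy
        exact h3 ⟨z, h, fun h' => hy (h' y hz)⟩
    · intro h
      exact ⟨fun y hy => h y ⟨x, Or.inl rfl, hy⟩, fun z hz y hy => h y ⟨z, Or.inr (Or.inl hz), hy⟩,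
        fun ⟨z, hz, hn⟩ => hn fun y hy => h y ⟨z, Or.inr (Or.inr hz), hy⟩⟩

theorem sat_subst {s : ℕ → Formula} :
    F.Sat V x (φ.subst s) ↔ F.Sat (fun i => {y | F.Sat V y (s i)}) x φ := by
  induction φ generalizing x with
  | var i => rfl
  | bot => rfl
  | imp φ ψ h1 h2 => simp only [Formula.subst, sat_imp, h1, h2]
  | box φ h => simp only [Formula.subst, sat_box, h]
  | bdia φ h => simp only [Formula.subst, sat_bdia, h]

end Sat

/-! ### Zigzag distance in a frame. -/

section Near

variable {F : Frame.{u}}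

theorem Near.trans {a b : ℕ} {x y z : F.World} (h : F.Near a x y) (h' : F.Near b y z) :
    F.Near (a + b) x z := by
  induction a generalizing x with
  | zero => obtain rfl : x = y := h; simpa using h'
  | succ a ih =>
    obtain ⟨t, ht, hty⟩ := h
    rw [Nat.succ_add]
    exact ⟨t, ht, ih hty⟩

theorem near_one {x y : F.World} (h : x = y ∨ F.Rel x y ∨ F.Rel y x) : F.Near 1 x y :=
  ⟨y, h, rfl⟩

theorem near_self (k : ℕ) (x : F.World) : F.Near k x x := by
  induction k with
  | zero => rfl
  | succ k ih => exact ⟨x, Or.inl rfl, ih⟩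

theorem Near.mono {a b : ℕ} (hab : a ≤ b) {x y : F.World} (h : F.Near a x y) : F.Near b x y := by
  have := h.trans (near_self (b - a) y)
  rwa [Nat.add_sub_cancel' hab] at this

theorem Near.symm {a : ℕ} {x y : F.World} (h : F.Near a x y) : F.Near a y x := by
  induction a generalizing x with
  | zero => exact Eq.symm h
  | succ a ih =>
    obtain ⟨t, ht, hty⟩ := h
    refine (ih hty).trans (near_one ?_)
    rcases ht with rfl | h | h
    exacts [Or.inl rfl, Or.inr (Or.inr h), Or.inr (Or.inl h)]

end Near

/-! ### Logics of general frames -/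

/-- The sets in `P` form a general frame over `F`. -/
structure IsGeneral (F : Frame.{u}) (P : Set (Set F.World)) : Prop where
  empty : ∅ ∈ P
  imp : ∀ A ∈ P, ∀ B ∈ P, {x | x ∈ A → x ∈ B} ∈ P
  box : ∀ A ∈ P, {x | ∀ y, F.Rel x y → y ∈ A} ∈ P
  bdia : ∀ A ∈ P, {x | ∃ y, F.Rel y x ∧ y ∈ A} ∈ P

/-- The logic of the general frame `(F, P)`. -/
def logic (F : Frame.{u}) (P : Set (Set F.World)) : Set Formula :=
  {φ | ∀ V : ℕ → Set F.World, (∀ i, V i ∈ P) → ∀ x, F.Sat V x φ}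

theorem IsGeneral.sat_mem {F : Frame.{u}} {P : Set (Set F.World)} (hP : F.IsGeneral P)
    {V : ℕ → Set F.World} (hV : ∀ i, V i ∈ P) (φ : Formula) : {x | F.Sat V x φ} ∈ P := by
  induction φ with
  | var i => exact hV i
  | bot => exact hP.empty
  | imp φ ψ h1 h2 => exact hP.imp _ h1 _ h2
  | box φ h => exact hP.box _ h
  | bdia φ h => exact hP.bdia _ h

theorem IsGeneral.isTenseLogic {F : Frame.{u}} {P : Set (Set F.World)} (hP : F.IsGeneral P) :
    IsTenseLogic (F.logic P) where
  taut φ h V _ x := h (F.Sat V x) id fun _ _ => Iff.rfl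
  adj φ ψ := by
    constructor
    · intro h V hV x hx y hxy
      exact h V hV y ⟨x, hxy, hx⟩
    · rintro h V hV x ⟨y, hyx, hy⟩
      exact h V hV y hy x hyx
  mp φ ψ h h' V hV x := h' V hV x (h V hV x)
  subst s φ h V hV x := sat_subst.2 (h _ (fun i => hP.sat_mem hV (s i)) x)

theorem isGeneral_univ (F : Frame.{u}) : F.IsGeneral Set.univ := by
  constructor <;> intros <;> trivial

end Frame

theorem sat_of_mem_Kt {φ : Formula} (h : φ ∈ Kt) (F : Frame.{u}) (V : ℕ → Set F.World)
    (x : F.World) : F.Sat V x φ :=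
  h _ F.isGeneral_univ.isTenseLogic V (fun _ => trivial) x

/-! ### Derivability in tense logics -/

namespace IsTenseLogic

variable {L : Set Formula}

theorem imp_trans (hL : IsTenseLogic L) {α β γ : Formula} (h : imp α β ∈ L) (h' : imp β γ ∈ L) :
    imp α γ ∈ L := by
  refine hL.mp _ _ h' (hL.mp _ _ h (hL.taut _ ?_))
  intro v _ hi
  simp only [hi]; tauto

theorem bdia_mono (hL : IsTenseLogic L) {α β : Formula} (h : imp α β ∈ L) :
    imp (bdia α) (bdia β) ∈ L := by
  refine (hL.adj _ _).2 (hL.imp_trans h ((hL.adj _ _).1 (hL.taut _ ?_)))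
  intro v _ hi
  simp only [hi]; tauto

theorem imp_box_bdia (hL : IsTenseLogic L) (α : Formula) : imp α (box (bdia α)) ∈ L := by
  refine (hL.adj _ _).1 (hL.taut _ ?_)
  intro v _ hi
  simp only [hi]; tauto

theorem bdia_box_imp (hL : IsTenseLogic L) (α : Formula) : imp (bdia (box α)) α ∈ L := by
  refine (hL.adj _ _).2 (hL.taut _ ?_)
  intro v _ hi
  simp only [hi]; tauto

theorem box_mono (hL : IsTenseLogic L) {α β : Formula} (h : imp α β ∈ L) :
    imp (box α) (box β) ∈ L :=
  (hL.adj _ _).1 (hL.imp_trans (hL.bdia_box_imp α) h)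

theorem nec (hL : IsTenseLogic L) {α : Formula} (h : α ∈ L) : box α ∈ L := by
  have h1 : imp (bdia top) α ∈ L := by
    refine hL.mp _ _ h (hL.taut _ ?_)
    intro v _ hi
    simp only [hi]; tauto
  refine hL.mp _ _ ((hL.adj _ _).1 h1) (hL.taut _ ?_)
  intro v h0 hi
  simp only [hi, top, neg]; tauto

theorem nec_past (hL : IsTenseLogic L) {α : Formula} (h : α ∈ L) : neg (bdia (neg α)) ∈ L := by
  refine (hL.adj _ _).2 (hL.mp _ _ h (hL.taut _ ?_))
  intro v h0 hi
  simp only [hi, neg]; tauto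

theorem box_K (hL : IsTenseLogic L) (α β : Formula) :
    imp (box (imp α β)) (imp (box α) (box β)) ∈ L := by
  have h1 : imp (bdia (and (box (imp α β)) (box α))) (imp α β) ∈ L := by
    refine hL.imp_trans (hL.bdia_mono (hL.taut _ ?_)) (hL.bdia_box_imp _)
    intro v h0 hi
    simp only [hi, Formula.and, neg]; tauto
  have h2 : imp (bdia (and (box (imp α β)) (box α))) α ∈ L := by
    refine hL.imp_trans (hL.bdia_mono (hL.taut _ ?_)) (hL.bdia_box_imp _)
    intro v h0 hi
    simp only [hi, Formula.and, neg]; tauto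
  have h3 : imp (bdia (and (box (imp α β)) (box α))) β ∈ L := by
    refine hL.mp _ _ h1 (hL.mp _ _ h2 (hL.taut _ ?_))
    intro v h0 hi
    simp only [hi]; tauto
  refine hL.mp _ _ ((hL.adj _ _).1 h3) (hL.taut _ ?_)
  intro v h0 hi
  simp only [hi, Formula.and, neg]; tauto

theorem bdia_or (hL : IsTenseLogic L) (α β : Formula) :
    imp (bdia (or α β)) (or (bdia α) (bdia β)) ∈ L := by
  have h1 : imp α (box (or (bdia α) (bdia β))) ∈ L := by
    refine hL.imp_trans (hL.imp_box_bdia α) (hL.box_mono (hL.taut _ ?_))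
    intro v h0 hi
    simp only [hi, Formula.or, neg]; tauto
  have h2 : imp β (box (or (bdia α) (bdia β))) ∈ L := by
    refine hL.imp_trans (hL.imp_box_bdia β) (hL.box_mono (hL.taut _ ?_))
    intro v h0 hi
    simp only [hi, Formula.or, neg]; tauto
  refine (hL.adj _ _).2 (hL.mp _ _ h1 (hL.mp _ _ h2 (hL.taut _ ?_)))
  intro v h0 hi
  simp only [hi, Formula.or, neg]; tauto

theorem nboxPow (hL : IsTenseLogic L) {α : Formula} (h : α ∈ L) (k : ℕ) : nboxPow α k ∈ L := by
  induction k with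
  | zero => exact h
  | succ k ih =>
    refine hL.mp _ _ ih (hL.mp _ _ (hL.nec ih) (hL.mp _ _ (hL.nec_past ih) (hL.taut _ ?_)))
    intro v h0 hi
    simp only [hi, Formula.and, neg, Formula.nboxPow, nbox]; tauto

theorem or_left (hL : IsTenseLogic L) {α : Formula} (h : α ∈ L) (β : Formula) : or α β ∈ L := by
  refine hL.mp _ _ h (hL.taut _ ?_)
  intro v h0 hi
  simp only [hi, Formula.or, neg]; tauto

theorem or_right (hL : IsTenseLogic L) {β : Formula} (h : β ∈ L) (α : Formula) : or α β ∈ L := by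
  refine hL.mp _ _ h (hL.taut _ ?_)
  intro v h0 hi
  simp only [hi, Formula.or]; tauto

theorem inter (hL : IsTenseLogic L) {L' : Set Formula} (hL' : IsTenseLogic L') :
    IsTenseLogic (L ∩ L') where
  taut φ h := ⟨hL.taut φ h, hL'.taut φ h⟩
  adj φ ψ := and_congr (hL.adj φ ψ) (hL'.adj φ ψ)
  mp φ ψ h h' := ⟨hL.mp φ ψ h.1 h'.1, hL'.mp φ ψ h.2 h'.2⟩
  subst s φ h := ⟨hL.subst s φ h.1, hL'.subst s φ h.2⟩

theorem biInter {ι : Type*} {S : ι → Set Formula} (hS : ∀ i, IsTenseLogic (S i)) (I : Set ι) :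
    IsTenseLogic {φ | ∀ i ∈ I, φ ∈ S i} where
  taut φ h i _ := (hS i).taut φ h
  adj φ ψ := forall₂_congr fun i _ => (hS i).adj φ ψ
  mp φ ψ h h' i hi := (hS i).mp φ ψ (h i hi) (h' i hi)
  subst s φ h i hi := (hS i).subst s φ (h i hi)

end IsTenseLogic

/-! ### Completeness by the canonical model -/

/-- Derivability from hypotheses `Γ` by modus ponens over the logic `L`. -/
inductive Ded (L Γ : Set Formula) : Formula → Prop
  | ax {φ} : φ ∈ L → Ded L Γ φ
  | hyp {φ} : φ ∈ Γ → Ded L Γ φ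
  | mp {φ ψ} : Ded L Γ φ → Ded L Γ (imp φ ψ) → Ded L Γ ψ

/-- The maximal `L`-consistent sets. -/
structure IsMCS (L Γ : Set Formula) : Prop where
  sub : L ⊆ Γ
  bot : bot ∉ Γ
  imp : ∀ α β, imp α β ∈ Γ ↔ (α ∈ Γ → β ∈ Γ)

theorem IsMCS.neg {L Γ : Set Formula} (h : IsMCS L Γ) {α : Formula} : neg α ∈ Γ ↔ α ∉ Γ := by
  have := h.bot
  rw [Formula.neg, h.imp]; tauto

theorem Ded.deduction {L Γ : Set Formula} (hL : IsTenseLogic L) {α β : Formula}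
    (h : Ded L (insert α Γ) β) : Ded L Γ (imp α β) := by
  have weak : ∀ {χ}, Ded L Γ χ → Ded L Γ (Formula.imp α χ) := fun {χ} h => by
    refine h.mp (.ax (hL.taut _ ?_))
    intro v h0 hi
    simp only [hi]; tauto
  induction h with
  | ax h => exact weak (.ax h)
  | hyp h =>
    rcases h with rfl | h
    · refine .ax (hL.taut _ ?_)
      intro v h0 hi
      simp only [hi]; tauto
    · exact weak (.hyp h)
  | mp _ _ h1 h2 =>
    refine h1.mp (h2.mp (.ax (hL.taut _ ?_)))
    intro v h0 hi
    simp only [hi]; tauto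

theorem Ded.mono {L Γ Δ : Set Formula} (h : Γ ⊆ Δ) {α : Formula} (hα : Ded L Γ α) :
    Ded L Δ α := by
  induction hα with
  | ax h => exact .ax h
  | hyp h' => exact .hyp (h h')
  | mp _ _ h1 h2 => exact h1.mp h2

theorem Ded.exists_of_sUnion {L : Set Formula} {c : Set (Set Formula)} (hc : IsChain (· ⊆ ·) c)
    (hne : c.Nonempty) {α : Formula} (h : Ded L (⋃₀ c) α) : ∃ Γ ∈ c, Ded L Γ α := by
  induction h with
  | ax h => exact ⟨_, hne.some_mem, .ax h⟩
  | hyp h => obtain ⟨Γ, hΓ, hm⟩ := h; exact ⟨Γ, hΓ, .hyp hm⟩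
  | mp _ _ h1 h2 =>
    obtain ⟨Γ, hΓ, h1⟩ := h1
    obtain ⟨Δ, hΔ, h2⟩ := h2
    rcases hc.total hΓ hΔ with h | h
    · exact ⟨Δ, hΔ, (h1.mono h).mp h2⟩
    · exact ⟨Γ, hΓ, h1.mp (h2.mono h)⟩

theorem exists_isMCS {L Γ : Set Formula} (hL : IsTenseLogic L) {α : Formula} (h : ¬ Ded L Γ α) :
    ∃ Δ, IsMCS L Δ ∧ Γ ⊆ Δ ∧ α ∉ Δ := by
  obtain ⟨Δ, hΓ, hmax⟩ := zorn_subset_nonempty {Δ | ¬ Ded L Δ α} (fun c hc hchain hne =>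
    ⟨⋃₀ c, fun hd => by
      obtain ⟨Δ, hΔ, hd⟩ := hd.exists_of_sUnion hchain hne
      exact hc hΔ hd, fun s hs => Set.subset_sUnion_of_mem hs⟩) Γ h
  have key : ∀ β, β ∉ Δ → Ded L Δ (imp β α) := fun β hβ => by
    by_contra hn
    have h1 : ¬ Ded L (insert β Δ) α := fun hd => hn (hd.deduction hL)
    exact hβ (hmax.2 h1 (Set.subset_insert _ _) (Set.mem_insert _ _))
  have cl : ∀ β, Ded L Δ β → β ∈ Δ := fun β hβ => by
    by_contra hn
    exact hmax.1 (hβ.mp (key β hn))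
  refine ⟨Δ, ⟨fun β hβ => cl _ (.ax hβ), ?_, ?_⟩, hΓ, fun ha => hmax.1 (.hyp ha)⟩
  · intro hb
    refine hmax.1 ((Ded.hyp hb).mp (.ax (hL.taut _ ?_)))
    intro v h0 hi
    simp only [hi]; tauto
  · intro β γ
    refine ⟨fun h1 h2 => cl _ ((Ded.hyp h2).mp (.hyp h1)), fun h1 => ?_⟩
    by_cases hβ : β ∈ Δ
    · refine cl _ ((Ded.hyp (h1 hβ)).mp (.ax (hL.taut _ ?_)))
      intro v h0 hi
      simp only [hi]; tauto
    · by_contra h2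
      refine hmax.1 ((key _ h2).mp ((key _ hβ).mp (.ax (hL.taut _ ?_))))
      intro v h0 hi
      simp only [hi]; tauto

/-- The canonical frame of a logic. -/
def canonicalFrame (L : Set Formula) (h : Nonempty {Γ // IsMCS L Γ}) : Frame.{0} where
  World := {Γ // IsMCS L Γ}
  nonempty := h
  Rel Γ Δ := ∀ α, box α ∈ Γ.1 → α ∈ Δ.1

/-- The canonical relation is defined through □ alone; the two adjunction laws α → □⧫α and ⧫□α → α
make the same relation interpret ⧫ as well. -/
theorem sat_canonical {L : Set Formula} (hL : IsTenseLogic L) (h : Nonempty {Γ // IsMCS L Γ})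
    (φ : Formula) (Γ : (canonicalFrame L h).World) :
    (canonicalFrame L h).Sat (fun i => {Δ | var i ∈ Δ.1}) Γ φ ↔ φ ∈ Γ.1 := by
  induction φ generalizing Γ with
  | var i => rfl
  | bot => exact iff_of_false id Γ.2.bot
  | imp φ ψ h1 h2 => rw [Frame.sat_imp, h1, h2, Γ.2.imp]
  | box φ ih =>
    simp only [Frame.sat_box, ih]
    refine ⟨fun H => ?_, fun H Δ hΔ => hΔ _ H⟩
    by_contra hn
    have hd : ¬ Ded L {χ | box χ ∈ Γ.1} φ := by
      intro hd
      refine hn ?_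
      clear hn H ih
      induction hd with
      | ax h => exact Γ.2.sub (hL.nec h)
      | hyp h => exact h
      | mp _ _ h1 h2 =>
        exact (Γ.2.imp _ _).1 ((Γ.2.imp _ _).1 (Γ.2.sub (hL.box_K _ _)) h2) h1
    obtain ⟨Δ, hΔ, hsub, hφ⟩ := exists_isMCS hL hd
    exact hφ (H ⟨Δ, hΔ⟩ fun α hα => hsub hα)
  | bdia φ ih =>
    simp only [Frame.sat_bdia, ih]
    constructor
    · rintro ⟨Δ, hΔ, hφ⟩
      exact hΔ _ ((Δ.2.imp _ _).1 (Δ.2.sub (hL.imp_box_bdia φ)) hφ)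
    · intro H
      have mono : ∀ {α β}, imp α β ∈ L → bdia α ∈ Γ.1 → bdia β ∈ Γ.1 := fun hab =>
        (Γ.2.imp _ _).1 (Γ.2.sub (hL.bdia_mono hab))
      -- The hypotheses are the formulas that Γ requires at all predecessors; a predecessor
      -- satisfying φ is obtained by extending them.
      have hd : ¬ Ded L {χ | bdia (neg χ) ∉ Γ.1} (neg φ) := by
        intro hd
        have : ∀ χ, Ded L {χ | bdia (neg χ) ∉ Γ.1} χ → bdia (neg χ) ∉ Γ.1 := by
          intro χ hd
          induction hd with
          | ax h => exact Γ.2.neg.1 (Γ.2.sub (hL.nec_past h))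
          | hyp h => exact h
          | @mp α β _ _ h1 h2 =>
            intro h3
            have h4 : bdia (or (neg (imp α β)) (neg α)) ∈ Γ.1 := by
              refine mono (hL.taut _ ?_) h3
              intro v h0 hi
              simp only [hi, Formula.or, Formula.neg]; tauto
            have h5 := (Γ.2.imp _ _).1 (Γ.2.sub (hL.bdia_or _ _)) h4
            rw [Formula.or, Γ.2.imp, Γ.2.neg] at h5
            exact h1 (h5 h2)
        refine this _ hd (mono (hL.taut _ ?_) H)
        intro v h0 hi
        simp only [hi, Formula.neg]; tauto
      obtain ⟨Δ, hΔ, hsub, hφ⟩ := exists_isMCS hL hd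
      refine ⟨⟨Δ, hΔ⟩, fun α hα => ?_, by rwa [hΔ.neg, not_not] at hφ⟩
      by_contra hn
      refine hΔ.neg.1 (hsub (a := neg (box α)) ?_) hα
      intro h1
      refine hn ((Γ.2.imp _ _).1 (Γ.2.sub (hL.bdia_box_imp α)) (mono (hL.taut _ ?_) h1))
      intro v h0 hi
      simp only [hi, Formula.neg]; tauto

theorem exists_not_sat {L : Set Formula} (hL : IsTenseLogic L) {φ : Formula} (h : φ ∉ L) :
    ∃ (F : Frame.{0}) (V : ℕ → Set F.World) (x : F.World), ¬ F.Sat V x φ := by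
  have hd : ¬ Ded L ∅ φ := by
    intro hd
    refine h ?_
    clear h
    induction hd with
    | ax h => exact h
    | hyp h => exact h.elim
    | mp _ _ h1 h2 => exact hL.mp _ _ h1 h2
  obtain ⟨Δ, hΔ, -, hφ⟩ := exists_isMCS hL hd
  exact ⟨canonicalFrame L ⟨⟨Δ, hΔ⟩⟩, _, ⟨Δ, hΔ⟩, fun hs => hφ ((sat_canonical hL _ φ _).1 hs)⟩

/-! ### Formulas refuted at a point with a neighbour -/

/-- `◇⊤ ∨ ⧫⊤`. -/
def Formula.hasNeighbour : Formula := or (dia top) (bdia top)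

theorem Frame.sat_hasNeighbour {F : Frame.{u}} {V : ℕ → Set F.World} {x : F.World} :
    F.Sat V x hasNeighbour ↔ ∃ y, F.Rel x y ∨ F.Rel y x := by
  simp [hasNeighbour, exists_or]

theorem Frame.sat_congr_of_isolated {F : Frame.{0}} {G : Frame.{u}} {V : ℕ → Set F.World}
    {W : ℕ → Set G.World} {x : F.World} {y : G.World} (hx : ∀ z, ¬ (F.Rel x z ∨ F.Rel z x))
    (hy : ∀ z, ¬ (G.Rel y z ∨ G.Rel z y)) (hV : ∀ i, x ∈ V i ↔ y ∈ W i) (φ : Formula) :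
    F.Sat V x φ ↔ G.Sat W y φ := by
  simp only [not_or] at hx hy
  induction φ with
  | var i => exact hV i
  | bot => rfl
  | imp φ ψ h1 h2 => rw [Frame.sat_imp, h1, h2, Frame.sat_imp]
  | box φ => exact iff_of_true (fun z hz => ((hx z).1 hz).elim) fun z hz => ((hy z).1 hz).elim
  | bdia φ => exact iff_of_false (fun ⟨z, hz, _⟩ => (hx z).2 hz) fun ⟨z, hz, _⟩ => (hy z).2 hz

-- If ◇⊤ ∨ ⧫⊤ implied every member of L over K_t, then L would be K_t ⊕ (◇⊤ ∨ ⧫⊤) or K_t, according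
-- to whether L contains ◇⊤ ∨ ⧫⊤.
open Classical in
theorem exists_refuted_at_neighbour {L : Set Formula} (hL : L ∈ NExt Kt) (hKt : L ≠ Kt)
    (hD : L ≠ oplus Kt {hasNeighbour}) :
    ∃ φ ∈ L, ∃ (F : Frame.{0}) (V : ℕ → Set F.World) (x y : F.World),
      ¬ F.Sat V x φ ∧ (F.Rel x y ∨ F.Rel y x) := by
  obtain ⟨hL, hsub⟩ := hL
  suffices ∃ φ ∈ L, imp hasNeighbour φ ∉ Kt by
    obtain ⟨φ, hφ, hn⟩ := this
    obtain ⟨F, V, x, hx⟩ := exists_not_sat isTenseLogic_Kt hn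
    rw [Frame.sat_imp, Classical.not_imp, Frame.sat_hasNeighbour] at hx
    obtain ⟨⟨y, hy⟩, hx⟩ := hx
    exact ⟨φ, hφ, F, V, x, y, hx, hy⟩
  by_contra! H
  by_cases hmem : hasNeighbour ∈ L
  · refine hD (Set.Subset.antisymm (fun φ hφ L' hL' hs => ?_) fun φ hφ => hφ L hL ?_)
    · exact hL'.mp _ _ (hs (Or.inr rfl)) (hs (Or.inl (H φ hφ)))
    · exact Set.union_subset hsub (Set.singleton_subset_iff.2 hmem)
  · refine hKt (Set.Subset.antisymm (fun φ hφ => ?_) hsub)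
    by_contra hn
    obtain ⟨F, V, x, hx⟩ := exists_not_sat isTenseLogic_Kt hn
    have hiso : ∀ z, ¬ (F.Rel x z ∨ F.Rel z x) := fun z hz =>
      hx (sat_of_mem_Kt (H φ hφ) F V x (Frame.sat_hasNeighbour.2 ⟨z, hz⟩))
    -- Replacing variables by their constant truth values at the isolated point x makes φ fail at
    -- every isolated point of every frame, so the instance implies ◇⊤ ∨ ⧫⊤ in K_t.
    let s : ℕ → Formula := fun i => if x ∈ V i then top else bot
    refine hmem (hL.mp _ _ (hL.subst s φ hφ) (hsub ?_))
    by_contra hn'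
    obtain ⟨G, W, y, hy⟩ := exists_not_sat isTenseLogic_Kt hn'
    rw [Frame.sat_imp, Classical.not_imp, Frame.sat_hasNeighbour, not_exists,
      Frame.sat_subst] at hy
    refine hx ((Frame.sat_congr_of_isolated hiso hy.2 (fun i => ?_) φ).2 hy.1)
    by_cases h : x ∈ V i <;> simp [s, h]

/-! ### Intersection with a logic without frames -/

/-- The connected component of `x`. -/
def Frame.component (G : Frame.{u}) (x : G.World) : Frame.{u} where
  World := {y // ∃ k, G.Near k x y}
  nonempty := ⟨⟨x, 0, rfl⟩⟩
  Rel a b := G.Rel a.1 b.1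

theorem Frame.sat_component {G : Frame.{u}} {x : G.World} {V : ℕ → Set G.World}
    {y : (G.component x).World} {φ : Formula} :
    (G.component x).Sat (fun i => {z | z.1 ∈ V i}) y φ ↔ G.Sat V y.1 φ := by
  induction φ generalizing y with
  | var i => rfl
  | bot => rfl
  | imp φ ψ h1 h2 => rw [Frame.sat_imp, h1, h2, Frame.sat_imp]
  | box φ ih =>
    simp only [Frame.sat_box, ih]
    obtain ⟨y, k, hk⟩ := y
    exact ⟨fun h z hz => h ⟨z, k + 1, hk.trans (near_one (Or.inr (Or.inl hz)))⟩ hz,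
      fun h z hz => h z.1 hz⟩
  | bdia φ ih =>
    simp only [Frame.sat_bdia, ih]
    obtain ⟨y, k, hk⟩ := y
    exact ⟨fun ⟨z, hz, h⟩ => ⟨z.1, hz, h⟩,
      fun ⟨z, hz, h⟩ => ⟨⟨z, k + 1, hk.trans (near_one (Or.inr (Or.inr hz)))⟩, hz, h⟩⟩

/-- If ψ ∈ L fails at x, the component of x, not being a frame for L', refutes some θ ∈ L' at a
point k zigzag steps away. With disjoint variables, ψ or "θ within k steps" is in both logics yet
fails at x. -/
theorem Fr_inter_eq {L L' : Set Formula} (hL : IsTenseLogic L) (hL' : IsTenseLogic L')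
    (h : Fr.{u} L' = ∅) : Fr.{u} (L ∩ L') = Fr.{u} L := by
  refine Set.Subset.antisymm (fun G hG ψ hψ V x => ?_) fun G hG ψ hψ => hG ψ hψ.1
  by_contra hx
  refine (Set.eq_empty_iff_forall_notMem.1 h (G.component x)) fun θ hθ W y => ?_
  obtain ⟨k, hk⟩ := y.2
  let W' : ℕ → Set G.World := fun i => Subtype.val '' W i
  -- Even variables carry the refutation of ψ, odd ones that of θ.
  let U : ℕ → Set G.World := fun i => if i % 2 = 0 then V (i / 2) else W' (i / 2)
  have hψ' := hL.subst (fun i => var (2 * i)) ψ hψ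
  have hθ' := hL'.nboxPow (hL'.subst (fun i => var (2 * i + 1)) θ hθ) k
  have := hG _ ⟨hL.or_left hψ' _, hL'.or_right hθ' _⟩ U x
  rw [Frame.sat_or, Frame.sat_subst, Frame.sat_nboxPow] at this
  have e1 : (fun i => {y | G.Sat U y (var (2 * i))}) = V := by
    funext i
    simp [U]
  have e2 : (fun i => {y | G.Sat U y (var (2 * i + 1))}) = W' := by
    funext i
    have : (2 * i + 1) / 2 = i := by omega
    simp [U, this, Nat.add_mod]
  rw [e1] at this
  have h1 := (this.resolve_left hx) _ hk
  rw [Frame.sat_subst, e2, ← Frame.sat_component] at h1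
  have e3 : (fun i => {z : (G.component x).World | z.1 ∈ W' i}) = W := by
    funext i
    ext z
    exact Subtype.val_injective.mem_set_image
  rwa [e3] at h1

/-! ### A logic without frames -/

/-- Colour points by well-founded recursion so that the colour flips at each immediate successor;
two such steps from x show both colours above x. This is the refutation of McKinsey's formula. -/
theorem exists_alternating {X : Type*} {r : X → X → Prop} (wf : WellFounded r)
    (trans : ∀ x y z, r x y → r y z → r x z) (serial : ∀ x, ∃ y, r x y)
    (lin : ∀ x y z, r y x → r z x → y = z ∨ r y z ∨ r z y) :
    ∃ p : Set X, ∀ x, (∃ y, r x y ∧ y ∈ p) ∧ ∃ y, r x y ∧ y ∉ p := by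
  let cover : X → X → Prop := fun y x => r y x ∧ ∀ z, r y z → ¬ r z x
  obtain ⟨p, hp⟩ : ∃ p : X → Prop, ∀ x, p x ↔ ¬ ∃ y, cover y x ∧ p y := by
    -- Points without an immediate predecessor are coloured true.
    let f : ∀ x, (∀ y, r y x → Prop) → Prop := fun x q => ¬ ∃ y, ∃ h : cover y x, q y h.1
    refine ⟨wf.fix f, fun x => ?_⟩
    rw [wf.fix_eq]
    simp only [f, exists_prop]
  have succ : ∀ x, ∃ y, r x y ∧ (p y ↔ ¬ p x) := by
    intro x
    -- A minimal successor y covers x, and past linearity makes x its only immediate predecessor.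
    obtain ⟨y, hxy, hmin⟩ := wf.has_min {y | r x y} (serial x)
    have hc : cover x y := ⟨hxy, hmin⟩
    refine ⟨y, hxy, ?_⟩
    rw [hp y, not_iff_not]
    constructor
    · rintro ⟨z, hz, hpz⟩
      rcases lin y z x hz.1 hxy with rfl | h | h
      · exact hpz
      · exact (hz.2 _ h hxy).elim
      · exact (hmin _ h hz.1).elim
    · exact fun h => ⟨x, hc, h⟩
  refine ⟨{x | p x}, fun x => ?_⟩
  obtain ⟨y, hxy, hy⟩ := succ x
  obtain ⟨z, hyz, hz⟩ := succ y
  have hxz := trans _ _ _ hxy hyz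
  by_cases h : p x
  · exact ⟨⟨z, hxz, by simp only [Set.mem_ofPred_eq]; tauto⟩,
      ⟨y, hxy, by simp only [Set.mem_ofPred_eq]; tauto⟩⟩
  · exact ⟨⟨y, hxy, by simp only [Set.mem_ofPred_eq]; tauto⟩,
      ⟨z, hxz, by simp only [Set.mem_ofPred_eq]; tauto⟩⟩

/-- Axioms, relativised to `α`, that have no common Kripke frame: an `α`-point is within reach, and
on `α`-points the relation is serial, transitive, well-founded, linear towards the past and
satisfies the McKinsey formula. -/
def noFrameAxioms (α : Formula) (k : ℕ) : Set Formula :=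
  {neg (nboxPow (neg α) k),
    imp α (dia α),
    imp (dia (and α (dia (and α (var 0))))) (imp α (dia (and α (var 0)))),
    imp (bdia (and α (var 0))) (imp α (bdia (and (and α (var 0)) (neg (bdia (and α (var 0))))))),
    imp (bdia (and α (var 0))) (imp (bdia (and α (var 1))) (imp α
      (or (bdia (and (var 0) (var 1))) (or (bdia (and (var 0) (bdia (and α (var 1)))))
        (bdia (and (var 1) (bdia (and α (var 0))))))))),
    imp (box (imp α (dia (and α (var 0))))) (imp α (dia (and α (box (imp α (var 0))))))}

theorem Fr_eq_empty_of_noFrameAxioms {L : Set Formula} (m k : ℕ)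
    (h : noFrameAxioms (diaPow m) k ⊆ L) : Fr.{u} L = ∅ := by
  refine Set.eq_empty_iff_forall_notMem.2 fun G hG => ?_
  have hG' : ∀ φ ∈ noFrameAxioms (diaPow m) k, G.Valid φ := fun φ hφ => hG φ (h hφ)
  simp only [noFrameAxioms, Set.mem_insert_iff, Set.mem_singleton_iff, forall_eq_or_imp,
    forall_eq, Frame.Valid, Frame.sat_neg, Frame.sat_nboxPow, Frame.sat_imp, Frame.sat_dia,
    Frame.sat_bdia, Frame.sat_and, Frame.sat_or, Frame.sat_box, Frame.sat_var,
    Frame.sat_diaPow] at hG'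
  obtain ⟨h1, h2, h3, h4, h5, h6⟩ := hG'
  let X := {x // G.HasChain m x}
  let r : X → X → Prop := fun x y => G.Rel x.1 y.1
  have wf : WellFounded r := by
    refine WellFounded.wellFounded_iff_has_min.2 fun S ⟨s, hs⟩ => ?_
    by_cases hc : ∃ t ∈ S, r t s
    · obtain ⟨t, ht, hts⟩ := hc
      obtain ⟨y, hys, ⟨hya, hyS⟩, hy⟩ := h4 (fun _ => Subtype.val '' S) s.1
        ⟨t.1, hts, t.2, t, ht, rfl⟩ s.2
      obtain ⟨y', hy', rfl⟩ := hyS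
      exact ⟨y', hy', fun z hz hzy => hy ⟨z.1, hzy, z.2, z, hz, rfl⟩⟩
    · exact ⟨s, hs, fun t ht hts => hc ⟨t, ht, hts⟩⟩
  have trans : ∀ x y z, r x y → r y z → r x z := by
    intro x y z hxy hyz
    obtain ⟨t, hxt, -, ht⟩ := h3 (fun _ => {z.1}) x.1 ⟨y.1, hxy, y.2, z.1, hyz, z.2, rfl⟩ x.2
    obtain rfl : t = z.1 := ht
    exact hxt
  have serial : ∀ x, ∃ y, r x y := by
    intro x
    obtain ⟨y, hxy, hy⟩ := h2 (fun _ => ∅) x.1 x.2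
    exact ⟨⟨y, hy⟩, hxy⟩
  have lin : ∀ x y z, r y x → r z x → y = z ∨ r y z ∨ r z y := by
    intro x y z hy hz
    rcases h5 (fun i => if i = 0 then {y.1} else {z.1}) x.1 ⟨y.1, hy, y.2, by simp⟩
      ⟨z.1, hz, z.2, by simp⟩ x.2 with ⟨t, -, h, h'⟩ | ⟨t, -, h, t', h', -, h''⟩ |
      ⟨t, -, h, t', h', -, h''⟩ <;> simp at h h'
    · subst h; exact Or.inl (Subtype.ext h')
    · simp at h''; subst h h''; exact Or.inr (Or.inr h')
    · simp at h''; subst h h''; exact Or.inr (Or.inl h')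
  obtain ⟨p, hp⟩ := exists_alternating wf trans serial lin
  obtain ⟨g⟩ := G.nonempty
  have hx := h1 (fun _ => ∅) g
  push Not at hx
  obtain ⟨x, -, hx⟩ := hx
  obtain ⟨y, -, hya, hy⟩ := h6 (fun _ => Subtype.val '' p) x (fun y _ hy => by
    obtain ⟨z, hz, hzp⟩ := (hp ⟨y, hy⟩).1
    exact ⟨z.1, hz, z.2, z, hzp, rfl⟩) hx
  obtain ⟨z, hz, hzp⟩ := (hp ⟨y, hya⟩).2
  exact hzp (Subtype.val_injective.mem_set_image.1 (hy z.1 hz z.2))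

/-! ### The glued frames -/

/-- `Walk F w i x h`: a zigzag walk of length `i` leads from `w` to `x`, with `h` the number of
forward steps minus the number of backward steps. -/
inductive Walk (F : Frame.{u}) (w : F.World) : ℕ → F.World → ℤ → Prop
  | nil : Walk F w 0 w 0
  | fwd {i x h y} : Walk F w i x h → F.Rel x y → Walk F w (i + 1) y (h + 1)
  | bwd {i x h y} : Walk F w i x h → F.Rel y x → Walk F w (i + 1) y (h - 1)

/-- A point of `F` at the end of a walk of length at most `N`. -/
@[ext] structure WalkPoint (F : Frame.{u}) (w : F.World) (N : ℕ) where
  pt : F.World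
  len : ℕ
  height : ℤ
  len_le : len ≤ N
  walk : Walk F w len pt height

/-- The points at the ends of walks from `w` of length at most `N`, together with a copy of
`(ℕ, <)` and an arrow from `n : ℕ` to the point `a`. -/
def glue (F : Frame.{u}) (w : F.World) (N : ℕ) (a : WalkPoint F w N) (n : ℕ) : Frame.{u} where
  World := WalkPoint F w N ⊕ ℕ
  nonempty := ⟨Sum.inr 0⟩
  Rel
    | Sum.inl b, Sum.inl c => F.Rel b.pt c.pt ∧ c.height = b.height + 1 ∧
        (c.len = b.len + 1 ∨ b.len = c.len + 1)
    | Sum.inl _, Sum.inr _ => False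
    | Sum.inr i, Sum.inl c => i = n ∧ c = a
    | Sum.inr i, Sum.inr j => i < j

theorem Walk.abs_le {F : Frame.{u}} {w : F.World} {i : ℕ} {x : F.World} {h : ℤ}
    (hw : Walk F w i x h) : -(i : ℤ) ≤ h ∧ h ≤ i := by
  induction hw with
  | nil => simp
  | fwd _ _ ih => push_cast; omega
  | bwd _ _ ih => push_cast; omega

/-- A walk can always be prolonged by retracing its last edge; this is where the neighbour of w is
needed. -/
theorem exists_walk {F : Frame.{u}} {w v : F.World} (hv : F.Rel w v ∨ F.Rel v w) (i : ℕ) :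
    ∃ x h, Walk F w i x h ∧ ∃ y, F.Rel x y ∨ F.Rel y x := by
  induction i with
  | zero => exact ⟨w, 0, .nil, v, hv⟩
  | succ i ih =>
    obtain ⟨x, h, hw, y, hy | hy⟩ := ih
    · exact ⟨y, _, hw.fwd hy, x, Or.inr hy⟩
    · exact ⟨y, _, hw.bwd hy, x, Or.inl hy⟩

/-! ### Truth, chains and distances in the glued frames. -/

section Glue

variable {F : Frame.{u}} {w : F.World} {N : ℕ} {a : WalkPoint F w N} {n : ℕ}

/-- The copy of a walk point in the glued frame. -/
def gluePoint (b : WalkPoint F w N) : (glue F w N a n).World := Sum.inl b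

/-- The copy of a natural number in the glued frame. -/
def glueNat (i : ℕ) : (glue F w N a n).World := Sum.inr i

@[simp] theorem glue_rel_point_point {b c : WalkPoint F w N} :
    (glue F w N a n).Rel (gluePoint b) (gluePoint c) ↔ F.Rel b.pt c.pt ∧
      c.height = b.height + 1 ∧ (c.len = b.len + 1 ∨ b.len = c.len + 1) := Iff.rfl

@[simp] theorem not_glue_rel_point_nat {b : WalkPoint F w N} {i : ℕ} :
    ¬ (glue F w N a n).Rel (gluePoint b) (glueNat i) := id

@[simp] theorem glue_rel_nat_point {b : WalkPoint F w N} {i : ℕ} :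
    (glue F w N a n).Rel (glueNat i) (gluePoint b) ↔ i = n ∧ b = a := Iff.rfl

@[simp] theorem glue_rel_nat_nat {i j : ℕ} :
    (glue F w N a n).Rel (glueNat i) (glueNat j) ↔ i < j := Iff.rfl

theorem exists_glue {p : (glue F w N a n).World → Prop} :
    (∃ x, p x) ↔ (∃ b : WalkPoint F w N, p (gluePoint b)) ∨ ∃ i : ℕ, p (glueNat i) := Sum.exists

theorem forall_glue {p : (glue F w N a n).World → Prop} :
    (∀ x, p x) ↔ (∀ b : WalkPoint F w N, p (gluePoint b)) ∧ ∀ i : ℕ, p (glueNat i) := Sum.forall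

/-- The subsets of the glued frame that are finite or cofinite on `ℕ`. -/
def glueSets (F : Frame.{u}) (w : F.World) (N : ℕ) (a : WalkPoint F w N) (n : ℕ) :
    Set (Set (glue F w N a n).World) :=
  {A | (∃ k, ∀ i, k ≤ i → glueNat i ∈ A) ∨ ∃ k, ∀ i, k ≤ i → glueNat i ∉ A}

theorem isGeneral_glueSets : (glue F w N a n).IsGeneral (glueSets F w N a n) where
  empty := Or.inr ⟨0, fun _ _ => id⟩
  imp := by
    rintro A hA B (⟨k, hk⟩ | ⟨k, hk⟩)
    · exact Or.inl ⟨k, fun i hi _ => hk i hi⟩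
    · rcases hA with ⟨l, hl⟩ | ⟨l, hl⟩
      · exact Or.inr ⟨max k l, fun i hi h => hk i (le_of_max_le_left hi)
          (h (hl i (le_of_max_le_right hi)))⟩
      · exact Or.inl ⟨l, fun i hi h => (hl i hi h).elim⟩
  box := by
    rintro A (⟨k, hk⟩ | ⟨k, hk⟩)
    -- Beyond n, all successors of a natural number are natural numbers.
    · refine Or.inl ⟨max k (n + 1), fun i hi => ?_⟩
      simp only [Set.mem_ofPred_eq, forall_glue, glue_rel_nat_point, glue_rel_nat_nat]
      exact ⟨fun b hb => by omega, fun j hj => hk j (by omega)⟩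
    · exact Or.inr ⟨0, fun i _ h => hk (k + i + 1) (by omega) (h _ (glue_rel_nat_nat.2 (by omega)))⟩
  bdia := by
    intro A _
    by_cases h : ∃ j : ℕ, glueNat j ∈ A
    · obtain ⟨j, hj⟩ := h
      exact Or.inl ⟨j + 1, fun i hi => ⟨glueNat j, hi, hj⟩⟩
    · refine Or.inr ⟨0, fun i _ => ?_⟩
      simp only [Set.mem_ofPred_eq, exists_glue, not_glue_rel_point_nat, glue_rel_nat_nat]
      rintro (⟨b, hb, _⟩ | ⟨j, _, hj⟩)
      exacts [hb, h ⟨j, hj⟩]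

/-- Each operator uses up one unit of depth and lengthens the walk by at most one. The foreign
predecessor n is seen only from a, whose length N leaves no depth for a modal operator. -/
theorem sat_glue {V : ℕ → Set F.World} {W : ℕ → Set (glue F w N a n).World}
    (ha : a.len = N) (hW : ∀ i, ∀ b : WalkPoint F w N, gluePoint b ∈ W i ↔ b.pt ∈ V i)
    (φ : Formula) (b : WalkPoint F w N) (hb : b.len + φ.depth ≤ N) :
    (glue F w N a n).Sat W (gluePoint b) φ ↔ F.Sat V b.pt φ := by
  induction φ generalizing b with
  | var i => exact hW i b
  | bot => rfl
  | imp φ ψ h1 h2 =>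
    simp only [depth] at hb
    rw [Frame.sat_imp, h1 b (by omega), h2 b (by omega), Frame.sat_imp]
  | box φ ih =>
    simp only [depth] at hb
    simp only [Frame.sat_box, forall_glue, glue_rel_point_point, not_glue_rel_point_nat]
    constructor
    · rintro ⟨h, -⟩ y hy
      let c : WalkPoint F w N := ⟨y, b.len + 1, b.height + 1, by omega, b.walk.fwd hy⟩
      exact (ih c (by simp only [c]; omega)).1 (h c ⟨hy, rfl, Or.inl rfl⟩)
    · intro h
      exact ⟨fun c hc => (ih c (by omega)).2 (h _ hc.1), fun _ => False.elim⟩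
  | bdia φ ih =>
    simp only [depth] at hb
    simp only [Frame.sat_bdia, exists_glue, glue_rel_point_point, glue_rel_nat_point]
    constructor
    · rintro (⟨c, hc, h⟩ | ⟨i, ⟨_, rfl⟩, _⟩)
      · exact ⟨c.pt, hc.1, (ih c (by omega)).1 h⟩
      · omega
    · rintro ⟨y, hy, h⟩
      let c : WalkPoint F w N := ⟨y, b.len + 1, b.height - 1, by omega, b.walk.bwd hy⟩
      exact Or.inl ⟨c, ⟨hy, by simp [c], Or.inr rfl⟩, (ih c (by simp only [c]; omega)).2 h⟩

theorem hasChain_glueNat (k i : ℕ) : (glue F w N a n).HasChain k (glueNat i) := by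
  induction k generalizing i with
  | zero => trivial
  | succ k ih => exact ⟨glueNat (i + 1), by simp, ih _⟩

/-- Arrows from walk points never enter ℕ and raise the height by one. Since heights lie in [-N, N],
no chain of length 2N + 1 starts at a walk point, even if F has cycles. -/
theorem height_add_le_of_hasChain {k : ℕ} {b : WalkPoint F w N}
    (h : (glue F w N a n).HasChain k (gluePoint b)) : b.height + k ≤ N := by
  induction k generalizing b with
  | zero =>
    have := b.walk.abs_le
    have := b.len_le
    push_cast
    omega
  | succ k ih =>
    rcases exists_glue.1 h with ⟨c, hc, h⟩ | ⟨i, hc, h⟩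
    · have := ih h
      have := hc.2.1
      push_cast
      omega
    · exact hc.elim

@[simp] theorem not_hasChain_gluePoint (b : WalkPoint F w N) :
    ¬ (glue F w N a n).HasChain (2 * N + 1) (gluePoint b) := by
  intro h
  have h1 := height_add_le_of_hasChain h
  have := b.walk.abs_le
  have := b.len_le
  push_cast at h1
  omega

theorem hasBChain_glueNat {k i : ℕ} : (glue F w N a n).HasBChain k (glueNat i) ↔ k ≤ i := by
  induction k generalizing i with
  | zero => simp [Frame.HasBChain]
  | succ k ih =>
    simp only [Frame.HasBChain, exists_glue, not_glue_rel_point_nat, glue_rel_nat_nat, ih, false_and,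
      exists_false, false_or]
    exact ⟨fun ⟨j, h, h'⟩ => by omega, fun h => ⟨k, by omega, le_rfl⟩⟩

/-- The starting point of the walks. -/
def WalkPoint.start (F : Frame.{u}) (w : F.World) (N : ℕ) : WalkPoint F w N :=
  ⟨w, 0, 0, Nat.zero_le _, .nil⟩

theorem near_start (b : WalkPoint F w N) :
    (glue F w N a n).Near N (gluePoint b) (gluePoint (WalkPoint.start F w N)) := by
  suffices ∀ {i x h}, Walk F w i x h → ∀ b : WalkPoint F w N, b.len = i → b.pt = x →
      b.height = h →
      (glue F w N a n).Near i (gluePoint b) (gluePoint (WalkPoint.start F w N)) from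
    (this b.walk b rfl rfl rfl).mono b.len_le
  intro i x h hw
  induction hw with
  | nil =>
    intro b h1 h2 h3
    exact congrArg gluePoint (WalkPoint.ext h2 h1 h3)
  | @fwd i x h y hw hr ih =>
    intro b h1 h2 h3
    have := b.len_le
    refine ⟨gluePoint ⟨x, i, h, by omega, hw⟩, Or.inr (Or.inr ?_), ih _ rfl rfl rfl⟩
    exact ⟨h2 ▸ hr, h3, Or.inl h1⟩
  | @bwd i x h y hw hr ih =>
    intro b h1 h2 h3
    have := b.len_le
    refine ⟨gluePoint ⟨x, i, h, by omega, hw⟩, Or.inr (Or.inl ?_), ih _ rfl rfl rfl⟩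
    exact ⟨h2 ▸ hr, by simp [h3], Or.inr h1⟩

theorem near_glueNat : (glue F w N a n).Near (N + 1) (gluePoint (WalkPoint.start F w N)) (glueNat n) :=
  (near_start a).symm.trans (Frame.near_one (Or.inr (Or.inr ⟨rfl, rfl⟩)))

theorem noFrameAxioms_subset_logic_glue :
    noFrameAxioms (diaPow (2 * N + 1)) (2 * N + 1) ⊆
      (glue F w N a n).logic (glueSets F w N a n) := by
  simp only [noFrameAxioms, Set.insert_subset_iff, Set.singleton_subset_iff, Frame.logic,
    Set.mem_ofPred_eq, Frame.sat_neg, Frame.sat_nboxPow, Frame.sat_imp, Frame.sat_dia,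
    Frame.sat_bdia, Frame.sat_and, Frame.sat_or, Frame.sat_box, Frame.sat_var,
    Frame.sat_diaPow, forall_glue, exists_glue, not_hasChain_gluePoint, hasChain_glueNat, glue_rel_nat_nat,
    not_glue_rel_point_nat, glue_rel_point_point, glue_rel_nat_point]
  simp only [false_imp_iff, imp_true_iff, false_and, and_false, exists_false, true_and, true_imp_iff,
    false_or, or_false, and_true]
  refine ⟨fun V hV => ⟨fun b h => ?_, fun i h => ?_⟩, fun V hV i => ⟨i + 1, by omega⟩,
    fun V hV i ⟨j, hij, k, hjk, hk⟩ => ⟨k, by omega, hk⟩, fun V hV i ⟨j, hji, hj⟩ => ?_,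
    fun V hV i ⟨j, hji, hj⟩ ⟨k, hki, hk⟩ => ?_, fun V hV i h => ?_⟩
  -- At most N steps lead to the start and N + 1 from there to n, hence the bound 2N + 1.
  · refine h.2 n ?_ trivial
    have := (near_start (a := a) (n := n) b).trans near_glueNat
    rwa [← add_assoc, ← two_mul] at this
  · exact h.2 i (Frame.near_self _ _) trivial
  · classical
    have hex : ∃ j : ℕ, glueNat j ∈ V 0 := ⟨j, hj⟩
    refine ⟨Nat.find hex, (Nat.find_min' hex hj).trans_lt hji, Nat.find_spec hex, ?_⟩
    rintro ⟨k, hk, hk'⟩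
    exact Nat.find_min hex hk hk'
  · rcases lt_trichotomy j k with h | rfl | h
    · exact Or.inr (Or.inr ⟨k, hki, hk, j, h, hj⟩)
    · exact Or.inl ⟨j, hji, hj, hk⟩
    · exact Or.inr (Or.inl ⟨j, hji, hj, k, h, hk⟩)
  -- McKinsey's formula is the only axiom that needs admissible valuations: a set unbounded in ℕ
  -- must be cofinite there.
  · rcases hV 0 with ⟨k, hk⟩ | ⟨k, hk⟩
    · exact ⟨i + k + 1, by omega, fun j hj => hk j (by omega)⟩
    · obtain ⟨j, hj, hj'⟩ := h (i + k + 1) (by omega)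
      exact (hk j (by omega) hj').elim

/-- All successors of the `α`-point of past depth `n` are `α`-points. -/
def Formula.noExit (α : Formula) (n : ℕ) : Formula :=
  imp (and α (and (bdiaPow n) (neg (bdiaPow (n + 1))))) (box α)

/-- The point i of ℕ has past depth exactly i, and n alone among them has a successor outside ℕ. -/
theorem noExit_mem_logic_glue {m : ℕ} (h : m ≠ n) :
    noExit (diaPow (2 * N + 1)) m ∈ (glue F w N a n).logic (glueSets F w N a n) := by
  intro V _
  refine forall_glue.2 ⟨fun b => by simp [noExit], fun i => ?_⟩
  simp only [noExit, Frame.sat_imp, Frame.sat_and, Frame.sat_bdiaPow, hasBChain_glueNat,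
    Frame.sat_neg, Frame.sat_box, Frame.sat_diaPow, forall_glue, glue_rel_nat_point]
  rintro ⟨-, h1, h2⟩
  exact ⟨fun b hb => by omega, fun j _ => hasChain_glueNat _ _⟩

theorem not_sat_noExit (V : ℕ → Set (glue F w N a n).World) :
    ¬ (glue F w N a n).Sat V (glueNat n) (noExit (diaPow (2 * N + 1)) n) := by
  simp only [noExit, Frame.sat_imp, Frame.sat_and, Frame.sat_bdiaPow, hasBChain_glueNat,
    Frame.sat_neg, Frame.sat_box, Frame.sat_diaPow, forall_glue, glue_rel_nat_point]
  intro h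
  exact not_hasChain_gluePoint a ((h ⟨hasChain_glueNat _ _, le_rfl, by omega⟩).1 a ⟨trivial, rfl⟩)

end Glue

/-! ### Counting -/

instance : Countable Formula := by
  let f : Formula → ℕ := fun φ => Formula.rec (fun i => Nat.pair 0 i) (Nat.pair 1 0)
    (fun _ _ a b => Nat.pair 2 (Nat.pair a b)) (fun _ a => Nat.pair 3 a)
    (fun _ a => Nat.pair 4 a) φ
  refine Function.Injective.countable (f := f) fun φ => ?_
  induction φ with
  | var i => intro ψ; cases ψ <;> simp [f, Nat.pair_eq_pair]
  | bot => intro ψ; cases ψ <;> simp [f, Nat.pair_eq_pair]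
  | imp α β h1 h2 =>
    intro ψ
    cases ψ <;> simp [f, Nat.pair_eq_pair]
    exact fun h h' => ⟨h1 h, h2 h'⟩
  | box α h1 =>
    intro ψ
    cases ψ <;> simp [f, Nat.pair_eq_pair]
    exact fun h => h1 h
  | bdia α h1 =>
    intro ψ
    cases ψ <;> simp [f, Nat.pair_eq_pair]
    exact fun h => h1 h

open Cardinal in
theorem deg_le (L₀ L : Set Formula) : deg.{u} L₀ L ≤ 2 ^ ℵ₀ :=
  calc deg.{u} L₀ L ≤ #(Set Formula) := mk_subtype_le _
    _ = 2 ^ #Formula := mk_set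
    _ ≤ 2 ^ ℵ₀ := power_le_power_left two_ne_zero mk_le_aleph0

open Cardinal in
theorem le_deg {L : Set Formula} (hL : L ∈ NExt Kt) {φ : Formula} (hφ : φ ∈ L) {F : Frame.{0}}
    {V : ℕ → Set F.World} {w v : F.World} (hw : ¬ F.Sat V w φ) (hv : F.Rel w v ∨ F.Rel v w) :
    2 ^ ℵ₀ ≤ deg.{u} Kt L := by
  let N := φ.depth
  obtain ⟨x, h, hx, -⟩ := exists_walk hv N
  let a : WalkPoint F w N := ⟨x, N, h, le_rfl, hx⟩
  let S : ℕ → Set Formula := fun n => (glue F w N a n).logic (glueSets F w N a n)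
  have hS : ∀ n, IsTenseLogic (S n) := fun n => isGeneral_glueSets.isTenseLogic
  let T : Set ℕ → Set Formula := fun I => {ψ | ∀ n ∈ I, ψ ∈ S n}
  have hT : ∀ I, IsTenseLogic (T I) := IsTenseLogic.biInter hS
  have hFr : ∀ I, Fr.{u} (T I) = ∅ := fun I =>
    Fr_eq_empty_of_noFrameAxioms (2 * N + 1) (2 * N + 1)
      fun ψ hψ n _ => noFrameAxioms_subset_logic_glue hψ
  -- N + 1 steps suffice to reach n from the starting point, where φ fails.
  let χ : ℕ → Formula := fun n => or φ (nboxPow (noExit (diaPow (2 * N + 1)) n) (N + 1))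
  have hχ : ∀ I n, χ n ∈ L ∩ T I ↔ n ∉ I := by
    intro I n
    constructor
    · rintro ⟨-, h⟩ hn
      -- The valuation of F is lifted to walk points and left empty on ℕ, which makes it admissible.
      let W : ℕ → Set (glue F w N a n).World :=
        fun i => {y | ∃ b : WalkPoint F w N, y = gluePoint b ∧ b.pt ∈ V i}
      have hW : ∀ i, W i ∈ glueSets F w N a n := fun i =>
        Or.inr ⟨0, fun j _ ⟨b, hb, _⟩ => Sum.inr_ne_inl hb⟩
      have hWV : ∀ i, ∀ b : WalkPoint F w N, gluePoint b ∈ W i ↔ b.pt ∈ V i := by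
        intro i b
        constructor
        · rintro ⟨c, hc, h⟩
          rwa [Sum.inl_injective hc]
        · exact fun h => ⟨b, rfl, h⟩
      have h1 := h n hn W hW (gluePoint (WalkPoint.start F w N))
      rw [Frame.sat_or, Frame.sat_nboxPow,
        sat_glue rfl hWV φ _ (by simp [WalkPoint.start, N])] at h1
      exact not_sat_noExit W ((h1.resolve_left hw) _ near_glueNat)
    · intro hn
      refine ⟨hL.1.or_left hφ _, (hT I).or_right ((hT I).nboxPow ?_ _) _⟩
      intro m hm
      exact noExit_mem_logic_glue fun h => hn (h ▸ hm)
  let f : Set ℕ → {L' : Set Formula // L' ∈ NExt Kt ∧ Fr.{u} L' = Fr.{u} L} := fun I =>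
    ⟨L ∩ T I, ⟨hL.1.inter (hT I), fun ψ hψ => hψ _ (hL.1.inter (hT I))⟩,
      Fr_inter_eq hL.1 (hT I) (hFr I)⟩
  have hf : Function.Injective f := by
    intro I J hIJ
    have hIJ' : L ∩ T I = L ∩ T J := congrArg Subtype.val hIJ
    ext n
    rw [← not_iff_not, ← hχ, ← hχ, hIJ']
  calc (2 : Cardinal.{0}) ^ ℵ₀ = #(Set ℕ) := by rw [mk_set, mk_nat]
    _ ≤ deg.{u} Kt L := mk_le_of_injective hf

end TenseLogic

theorem mainTheorem6 (L : Set TenseLogic.Formula)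
    (hL : L ∈ TenseLogic.NExt TenseLogic.Kt)
    (hKt : L ≠ TenseLogic.Kt)
    (hLstar : L ≠ TenseLogic.oplus TenseLogic.Kt
      {TenseLogic.Formula.or (TenseLogic.Formula.dia TenseLogic.Formula.top)
        (TenseLogic.Formula.bdia TenseLogic.Formula.top)}) :
    TenseLogic.deg.{u} TenseLogic.Kt L = (2 : Cardinal.{0}) ^ Cardinal.aleph0.{0} := by
  obtain ⟨φ, hφ, F, V, x, y, hx, hy⟩ := TenseLogic.exists_refuted_at_neighbour hL hKt hLstar
  exact le_antisymm (TenseLogic.deg_le _ _) (TenseLogic.le_deg hL hφ hx hy)
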